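/- Let $n\ge 1$, let $\|\cdot\|$ be any norm on $\mathbb C^n$, and let $B$ and $S$ be the open unit ball and the unit sphere of $E=(\mathbb C^n,\|\cdot\|)$. Let $\mathcal H^\infty(B)$ be the algebra of all bounded holomorphic functions $f\colon B\to\mathbb C$. For $f\in\mathcal H^\infty(B)$ and $z\in S$, let $Cl(f,z)$ be the set of all $\lambda\in\mathbb C$ for which there is a sequence $(x_k)$ in $B$ with $x_k\to z$ and $f(x_k)\to\lambda$. Let $$\mathcal F_S(B)=\{f\in\mathcal H^\infty(B):\ \text{there is } r>0 \text{ with } \{\lambda\in\mathbb C: |\lambda|<r\}\subset Cl(f,z)\text{ for every } z\in S\}.$$ Then $\mathcal F_S(B)$ is strongly $\mathfrak c$-algebrable, where $\mathfrak c$ is the cardinality of the continuum: there is an infinite algebraically independent set $G\subset\mathcal H^\infty(B)$ of cardinality $\mathfrak c$ such that the (not necessarily unital) subalgebra of $\mathcal H^\infty(B)$ generated by $G$, that is, the set of all $Q(g_1,\dots,g_m)$ with $m\ge 1$, $g_1,\dots,g_m\in G$ and $Q\in\mathbb C[X_1,\dots,X_m]$ without constant term, is contained in $\mathcal F_S(B)\cup\{0\}$.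 -/

import Mathlib

open Filter Topology Metric

/-- `H^∞(B)`: the complex algebra (under pointwise operations) of all bounded holomorphic functions
on the open unit ball `B` of a complex normed space `E`. Its elements are functions on `B` only;
holomorphic means complex (Fréchet) differentiable at every point of the open set `B`, which is
expressed through a function on `E` that restricts to `f` (its values off `B` play no role). -/
def HInf (E : Type*) [NormedAddCommGroup E] [NormedSpace ℂ E] :
    Subalgebra ℂ (ball (0 : E) 1 → ℂ) where
  carrier := {f | (∃ F : E → ℂ, DifferentiableOn ℂ F (ball 0 1) ∧ ∀ x : ball (0 : E) 1, f x = F x) ∧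
    ∃ C : ℝ, ∀ x, ‖f x‖ ≤ C}
  mul_mem' := by
    rintro f g ⟨⟨F, hF, hfF⟩, C, hC⟩ ⟨⟨G, hG, hgG⟩, D, hD⟩
    refine ⟨⟨fun x => F x * G x, hF.mul hG, fun x => by simp [hfF, hgG]⟩, C * D, fun x => ?_⟩
    rw [Pi.mul_apply, norm_mul]
    exact mul_le_mul (hC x) (hD x) (norm_nonneg _) ((norm_nonneg _).trans (hC x))
  add_mem' := by
    rintro f g ⟨⟨F, hF, hfF⟩, C, hC⟩ ⟨⟨G, hG, hgG⟩, D, hD⟩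
    exact ⟨⟨fun x => F x + G x, hF.add hG, fun x => by simp [hfF, hgG]⟩, C + D,
      fun x => (norm_add_le _ _).trans (add_le_add (hC x) (hD x))⟩
  algebraMap_mem' := fun c =>
    ⟨⟨fun _ => c, differentiableOn_const c, fun _ => rfl⟩, ‖c‖, fun _ => le_rfl⟩

/-- The cluster set `Cl(f, z)`: all limits of values of `f` along sequences in the open unit ball
that converge to `z`. -/
def clusterSet {E : Type*} [NormedAddCommGroup E] (f : ball (0 : E) 1 → ℂ) (z : E) : Set ℂ :=
  {w | ∃ u : ℕ → ball (0 : E) 1,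
    Tendsto (fun k => (u k : E)) atTop (𝓝 z) ∧ Tendsto (fun k => f (u k)) atTop (𝓝 w)}

/-- A subset `M` of a commutative complex algebra `A` is strongly `κ`-algebrable if there is an
infinite algebraically independent set `G ⊆ A` of cardinality `κ` such that the subalgebra
generated by `G` is contained in `M ∪ {0}`. Subalgebras need not contain the unit: the one generated
by `G` consists of the values at elements of `G` of the polynomials without constant term. -/
def StronglyAlgebrable {A : Type*} [CommRing A] [Algebra ℂ A] (κ : Cardinal) (M : Set A) : Prop :=
  ∃ G : Set A, G.Infinite ∧ Cardinal.mk G = κ ∧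
    AlgebraicIndependent ℂ (fun g : G => (g : A)) ∧
    (NonUnitalAlgebra.adjoin ℂ G : Set A) ⊆ M ∪ {0}

/-! A family `g a`, indexed by the continuum many `a : ℕ → Bool`, is built so that at every point of
the sphere any finitely many of its members cluster jointly at every point of the closed unit
polydisc. A nonzero polynomial `Q` without constant term is nonconstant on some complex line through
`0`, so by the open mapping theorem it sends the polydisc onto a neighbourhood of `0`. Hence the
cluster sets of `Q(g)` contain one disc, the same for all boundary points. In particular `Q(g) ≠ 0`,
which gives algebraic independence.

The family comes from two facts. `HInf.exists_asymptotic_interpolation`: near any sequence of unit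
vectors lie points of the ball where every sequence of targets in the closed disc is attained
asymptotically by some bounded holomorphic function. `exists_independent_targets`: countable
combinatorics gives one dense sequence of unit vectors and continuum many target sequences that are
jointly independent. Finite dimension enters through separability of the sphere. -/

/-! ### Limits of holomorphic functions -/

/-- A uniform limit of holomorphic functions on an open subset of a complex normed space is
holomorphic. -/
theorem DifferentiableOn.of_tendstoUniformlyOn {E : Type*} [NormedAddCommGroup E]
    [NormedSpace ℂ E] {U : Set E} (hU : IsOpen U) {F : ℕ → E → ℂ} {f : E → ℂ}
    (hF : ∀ n, DifferentiableOn ℂ (F n) U) (hf : TendstoUniformlyOn F f atTop U) :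
    DifferentiableOn ℂ f U := by
  intro x hx
  obtain ⟨R, hR, hRU⟩ := Metric.isOpen_iff.1 hU x hx
  have hsub : ∀ y ∈ ball x (R / 2), ball y (R / 2) ⊆ U := fun y hy =>
    (ball_subset_ball' (by rw [mem_ball] at hy; linarith)).trans hRU
  -- Cauchy estimate on balls of radius `R / 2`: `F m - F n` varies by less than `ε * R / 4` from
  -- its value at the centre, so its derivative there is at most `ε / 2`.
  have hcauchy : UniformCauchySeqOn (fun n => fderiv ℂ (F n)) atTop (ball x (R / 2)) := by
    rw [Metric.uniformCauchySeqOn_iff]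
    intro ε hε
    obtain ⟨N, hN⟩ := Metric.uniformCauchySeqOn_iff.1 hf.uniformCauchySeqOn (ε * R / 8)
      (by positivity)
    refine ⟨N, fun m hm n hn y hy => ?_⟩
    have hyU : y ∈ U := hsub y hy (mem_ball_self (by positivity))
    have hd : ∀ k, DifferentiableAt ℂ (F k) y := fun k => (hF k).differentiableAt (hU.mem_nhds hyU)
    rw [dist_eq_norm, ← fderiv_sub (hd m) (hd n)]
    have h := Complex.norm_fderiv_le_div_of_mapsTo_ball (R₂ := ε * R / 4)
      (((hF m).sub (hF n)).mono (hsub y hy)) ?_ (by positivity : 0 < R / 2)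
    · refine h.trans_lt ?_
      rw [div_lt_iff₀ (by positivity)]
      nlinarith [mul_pos hε hR]
    · intro z hz
      have h1 := hN m hm n hn z (hsub y hy hz)
      have h2 := hN m hm n hn y hyU
      rw [dist_eq_norm] at h1 h2
      rw [mem_closedBall, dist_eq_norm]
      refine (norm_sub_le _ _).trans ?_
      simp only [Pi.sub_apply]
      linarith
  have hlim : ∀ y ∈ ball x (R / 2), ∃ D, Tendsto (fun n => fderiv ℂ (F n) y) atTop (𝓝 D) :=
    fun y hy => cauchySeq_tendsto_of_complete (hcauchy.cauchySeq hy)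
  choose! D hD using hlim
  refine DifferentiableAt.differentiableWithinAt (HasFDerivAt.differentiableAt (f' := D x) ?_)
  refine hasFDerivAt_of_tendstoUniformlyOn (f := F) isOpen_ball
    (hcauchy.tendstoUniformlyOn_of_tendsto hD) (fun n y hy => ?_) (fun y hy => ?_)
    (mem_ball_self (by positivity))
  · exact ((hF n).differentiableAt
      (hU.mem_nhds (hsub y hy (mem_ball_self (by positivity))))).hasFDerivAt
  · exact hf.tendsto_at (hsub y hy (mem_ball_self (by positivity)))

/-! ### Peak functions on the disc -/

/-- A holomorphic function on the unit disc with values near the segment `[0, 1]`, small on a given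
smaller disc and close to `1` at some point near the boundary. -/
theorem exists_peak_function {ε r : ℝ} (hε : 0 < ε) (hr : r < 1) :
    ∃ ψ : ℂ → ℂ, ∃ s : ℝ, r ≤ s ∧ 1 - ε ≤ s ∧ 0 ≤ s ∧ s < 1 ∧ DifferentiableOn ℂ ψ (ball 0 1) ∧
      (∀ ζ ∈ ball (0 : ℂ) 1, ‖1 - ψ ζ‖ + ‖ψ ζ‖ ≤ 1 + ε) ∧
      (∀ ζ : ℂ, ‖ζ‖ ≤ r → ‖ψ ζ‖ ≤ ε) ∧ ‖1 - ψ s‖ ≤ ε := by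
  -- `L` maps the disc into the half-strip `0 ≤ Re`, `|Im| ≤ 2` and tends to infinity at `1`. The
  -- peak function is `ψ = δ L / (1 + δ L)`, with `1 - ψ = 1 / (1 + δ L)`; for small `δ` the set `δ
  -- L` hugs the positive real axis, so `ψ` stays near `[0, 1]`.
  set L : ℂ → ℂ := fun ζ => - Complex.log ((1 - ζ) / 2) with hL
  have hpos : ∀ ζ ∈ ball (0 : ℂ) 1, 0 < ((1 - ζ) / 2).re ∧ ‖(1 - ζ) / 2‖ ≤ 1 := by
    intro ζ hζ
    rw [mem_ball_zero_iff] at hζ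
    have h1 := (abs_le.1 (Complex.abs_re_le_norm ζ)).2
    have h2 : ‖1 - ζ‖ ≤ 2 := (norm_sub_le _ _).trans (by simp; linarith)
    constructor
    · have : ((1 - ζ) / 2).re = (1 - ζ.re) / 2 := by
        simp
      rw [this]; linarith
    · rw [norm_div]; simp; linarith
  have hre : ∀ ζ ∈ ball (0 : ℂ) 1, 0 ≤ (L ζ).re := by
    intro ζ hζ
    simp only [hL, Complex.neg_re, Complex.log_re]
    have := Real.log_nonpos (norm_nonneg _) (hpos ζ hζ).2
    linarith
  have him : ∀ ζ ∈ ball (0 : ℂ) 1, |(L ζ).im| ≤ 2 := by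
    intro ζ hζ
    simp only [hL, Complex.neg_im, Complex.log_im, abs_neg]
    have := Complex.abs_arg_le_pi_div_two_iff.2 (hpos ζ hζ).1.le
    linarith [Real.pi_lt_four]
  have hLd : DifferentiableOn ℂ L (ball 0 1) := by
    intro ζ hζ
    refine DifferentiableAt.differentiableWithinAt ?_
    refine DifferentiableAt.neg (DifferentiableAt.clog (by fun_prop) (Or.inl (hpos ζ hζ).1))
  obtain ⟨C, hC0, hC⟩ : ∃ C : ℝ, 0 < C ∧ ∀ ζ ∈ closedBall (0 : ℂ) r, ‖L ζ‖ ≤ C := by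
    obtain ⟨C, hC⟩ := (isCompact_closedBall (0 : ℂ) r).exists_bound_of_continuousOn
      (hLd.continuousOn.mono (closedBall_subset_ball hr))
    exact ⟨max C 1, by positivity, fun ζ hζ => (hC ζ hζ).trans (le_max_left _ _)⟩
  -- `2 * δ` bounds the excess of `‖1 - ψ‖ + ‖ψ‖` over `1`; `δ * C` bounds `ψ` on the disc of radius
  -- `r`.
  obtain ⟨δ, hδ, hδ1, hδ2⟩ : ∃ δ : ℝ, 0 < δ ∧ 2 * δ ≤ ε ∧ δ * C ≤ ε := by
    refine ⟨min (ε / 2) (ε / C), by positivity, ?_, ?_⟩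
    · linarith [min_le_left (ε / 2) (ε / C)]
    · have := min_le_right (ε / 2) (ε / C)
      rwa [le_div_iff₀ hC0] at this
  have hden : ∀ ζ ∈ ball (0 : ℂ) 1, 1 + δ * (L ζ).re ≤ ‖1 + δ * L ζ‖ := by
    intro ζ hζ
    refine le_trans (le_of_eq ?_) (Complex.re_le_norm _)
    simp
  have hden1 : ∀ ζ ∈ ball (0 : ℂ) 1, 1 ≤ ‖1 + δ * L ζ‖ := by
    intro ζ hζ
    have := hden ζ hζ
    nlinarith [mul_nonneg hδ.le (hre ζ hζ)]
  have hne : ∀ ζ ∈ ball (0 : ℂ) 1, 1 + δ * L ζ ≠ 0 := by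
    intro ζ hζ h
    have := hden1 ζ hζ
    rw [h] at this; simp at this; linarith
  have hsub : ∀ ζ ∈ ball (0 : ℂ) 1, 1 - δ * L ζ / (1 + δ * L ζ) = 1 / (1 + δ * L ζ) := by
    intro ζ hζ
    have := hne ζ hζ
    field_simp
    ring
  have hlim : Tendsto (fun s : ℝ => 1 + δ * (- Real.log ((1 - s) / 2))) (𝓝[<] 1) atTop := by
    have h1 : Tendsto (fun s : ℝ => (1 - s) / 2) (𝓝[<] 1) (𝓝[>] 0) := by
      refine tendsto_nhdsWithin_iff.2 ⟨?_, ?_⟩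
      · have : Tendsto (fun s : ℝ => (1 - s) / 2) (𝓝 1) (𝓝 ((1 - 1) / 2)) := by
          apply Continuous.tendsto; fun_prop
        simp only [sub_self, zero_div] at this
        exact this.mono_left nhdsWithin_le_nhds
      · filter_upwards [self_mem_nhdsWithin] with s hs
        simp only [Set.mem_Iio, Set.mem_Ioi] at *
        linarith
    have h2 := tendsto_neg_atBot_atTop.comp (Real.tendsto_log_nhdsGT_zero.comp h1)
    exact tendsto_atTop_add_const_left _ _ (h2.const_mul_atTop hδ)
  obtain ⟨s, hs, hsr, hs1⟩ : ∃ s : ℝ, 1 / ε ≤ 1 + δ * (- Real.log ((1 - s) / 2)) ∧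
      max (max r (1 - ε)) 0 ≤ s ∧ s < 1 := by
    have hm : max (max r (1 - ε)) 0 < 1 := by
      simp only [max_lt_iff]; exact ⟨⟨hr, by linarith⟩, one_pos⟩
    have := (hlim.eventually_ge_atTop (1 / ε)).and (Ico_mem_nhdsLT hm)
    obtain ⟨s, h1, h2⟩ := this.exists
    exact ⟨s, h1, h2.1, h2.2⟩
  simp only [max_le_iff] at hsr
  refine ⟨fun ζ => δ * L ζ / (1 + δ * L ζ), s, hsr.1.1, hsr.1.2, hsr.2, hs1, ?_, ?_, ?_, ?_⟩
  · exact (hLd.const_mul _).div ((hLd.const_mul _).const_add _) hne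
  · intro ζ hζ
    simp only [hsub ζ hζ]
    rw [norm_div, norm_div, ← add_div, norm_one, div_le_iff₀ (by linarith [hden1 ζ hζ])]
    have h1 : ‖(δ : ℂ) * L ζ‖ ≤ δ * (L ζ).re + 2 * δ := by
      rw [norm_mul, Complex.norm_real, Real.norm_of_nonneg hδ.le]
      have := Complex.norm_le_abs_re_add_abs_im (L ζ)
      rw [abs_of_nonneg (hre ζ hζ)] at this
      nlinarith [him ζ hζ]
    nlinarith [hden ζ hζ, hden1 ζ hζ]
  · intro ζ hζ
    have hb : ζ ∈ ball (0 : ℂ) 1 := by rw [mem_ball_zero_iff]; linarith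
    rw [norm_div]
    refine (div_le_self (norm_nonneg _) (hden1 ζ hb)).trans ?_
    rw [norm_mul, Complex.norm_real, Real.norm_of_nonneg hδ.le]
    refine le_trans ?_ hδ2
    gcongr
    exact hC ζ (by simpa using hζ)
  · have hb : (s : ℂ) ∈ ball (0 : ℂ) 1 := by
      rw [mem_ball_zero_iff, Complex.norm_real, Real.norm_of_nonneg hsr.2]; exact hs1
    simp only [hsub _ hb]
    have hLs : (L s).re = - Real.log ((1 - s) / 2) := by
      simp only [hL, Complex.neg_re, Complex.log_re]
      congr 2
      have : ((1 : ℂ) - s) / 2 = (((1 - s) / 2 : ℝ) : ℂ) := by push_cast; ring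
      rw [this, Complex.norm_real, Real.norm_of_nonneg (by linarith)]
    have h := hden _ hb
    rw [hLs] at h
    rw [norm_div, norm_one, one_div]
    refine inv_le_of_inv_le₀ hε ?_
    rw [← one_div]
    exact hs.trans h

/-- Peak functions `ψ k` with errors `1 / 2 ^ (k + 2)`, together with radii `r k` increasing to `1`
such that `ψ k` is small up to radius `r k` and close to `1` at `r (k + 1)`. -/
theorem exists_peak_sequence : ∃ (ψ : ℕ → ℂ → ℂ) (r : ℕ → ℝ), Monotone r ∧
    (∀ k, 0 ≤ r k ∧ r k < 1) ∧ (∀ k, 1 - 1 / 2 ^ (k + 2) ≤ r (k + 1)) ∧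
    (∀ k, DifferentiableOn ℂ (ψ k) (ball 0 1)) ∧
    (∀ k, ∀ ζ ∈ ball (0 : ℂ) 1, ‖1 - ψ k ζ‖ + ‖ψ k ζ‖ ≤ 1 + 1 / 2 ^ (k + 2)) ∧
    (∀ k, ∀ ζ : ℂ, ‖ζ‖ ≤ r k → ‖ψ k ζ‖ ≤ 1 / 2 ^ (k + 2)) ∧
    ∀ k, ‖1 - ψ k (r (k + 1))‖ ≤ 1 / 2 ^ (k + 2) := by
  have key : ∀ (k : ℕ) (r : Set.Ico (0 : ℝ) 1), ∃ (ψ : ℂ → ℂ) (s : Set.Ico (0 : ℝ) 1),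
      (r : ℝ) ≤ s ∧ 1 - 1 / 2 ^ (k + 2) ≤ (s : ℝ) ∧ DifferentiableOn ℂ ψ (ball 0 1) ∧
      (∀ ζ ∈ ball (0 : ℂ) 1, ‖1 - ψ ζ‖ + ‖ψ ζ‖ ≤ 1 + 1 / 2 ^ (k + 2)) ∧
      (∀ ζ : ℂ, ‖ζ‖ ≤ r → ‖ψ ζ‖ ≤ 1 / 2 ^ (k + 2)) ∧
      ‖1 - ψ (s : ℝ)‖ ≤ 1 / 2 ^ (k + 2) := by
    intro k r
    obtain ⟨ψ, s, h1, h2, h3, h4, h5, h6, h7, h8⟩ :=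
      exists_peak_function (ε := 1 / 2 ^ (k + 2)) (by positivity) r.2.2
    exact ⟨ψ, ⟨s, h3, h4⟩, h1, h2, h5, h6, h7, h8⟩
  choose ψ s h1 h2 h3 h4 h5 h6 using key
  let r : ℕ → Set.Ico (0 : ℝ) 1 := fun k => Nat.rec ⟨0, le_rfl, one_pos⟩ (fun k t => s k t) k
  let r' : ℕ → ℝ := fun k => (r k).1
  exact ⟨fun k => ψ k (r k), r', monotone_nat_of_le_succ fun k => h1 k (r k),
    fun k => (r k).2, fun k => h2 k (r k), fun k => h3 k (r k), fun k => h4 k (r k),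
    fun k => h5 k (r k), fun k => h6 k (r k)⟩

/-! ### Asymptotic interpolation -/

/-- The recursion `f (k + 1) = (1 - u k) f k + c k u k`, `f 0 = 0`. -/
def convexStep {E : Type*} (u : ℕ → E → ℂ) (c : ℕ → ℂ) : ℕ → E → ℂ
  | 0 => fun _ => 0
  | k + 1 => fun x => (1 - u k x) * convexStep u c k x + c k * u k x

/-- Each step is nearly a convex combination of the old value and `c k`. With `q = 1 / 2 ^ (k + 2)`,
the error factor `1 + q` is absorbed as the bound relaxes from `2 - 4 * q` to `2 - 2 * q`, because
`(1 + q) * (2 - 4 * q) ≤ 2 - 2 * q`. -/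
theorem norm_convexStep_le {E : Type*} {u : ℕ → E → ℂ} {c : ℕ → ℂ} (hc : ∀ k, ‖c k‖ ≤ 1) {x : E}
    (hu : ∀ k, ‖1 - u k x‖ + ‖u k x‖ ≤ 1 + 1 / 2 ^ (k + 2)) (k : ℕ) :
    ‖convexStep u c k x‖ ≤ 2 - 1 / 2 ^ k := by
  induction k with
  | zero => simp [convexStep]
  | succ k ih =>
    set q : ℝ := 1 / 2 ^ (k + 2) with hq
    have hq0 : 0 < q := by positivity
    have hq1 : (1 : ℝ) / 2 ^ k = 4 * q := by rw [hq, pow_add]; field_simp; norm_num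
    have hq2 : (1 : ℝ) / 2 ^ (k + 1) = 2 * q := by rw [hq, pow_add, pow_add]; field_simp
    have hq3 : 4 * q ≤ 1 := by
      rw [← hq1, div_le_one (by positivity)]; exact one_le_pow₀ (by norm_num)
    rw [hq1] at ih
    rw [hq2]
    have h : ‖convexStep u c (k + 1) x‖ ≤ ‖1 - u k x‖ * (2 - 4 * q) + 1 * ‖u k x‖ := by
      simp only [convexStep]
      refine (norm_add_le _ _).trans ?_
      rw [norm_mul, norm_mul]
      gcongr
      exact hc k
    nlinarith [hu k, norm_nonneg (1 - u k x), norm_nonneg (u k x)]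

/-- Where `u k` is small the step changes little, which gives convergence inside the ball. -/
theorem convexStep_succ_sub {E : Type*} (u : ℕ → E → ℂ) (c : ℕ → ℂ) (k : ℕ) (x : E) :
    convexStep u c (k + 1) x - convexStep u c k x = u k x * (c k - convexStep u c k x) := by
  simp only [convexStep]; ring

/-- Where `u k` is near `1` the step lands near `c k`, whatever the previous value. -/
theorem convexStep_succ_sub_target {E : Type*} (u : ℕ → E → ℂ) (c : ℕ → ℂ) (k : ℕ) (x : E) :
    convexStep u c (k + 1) x - c k = (1 - u k x) * (convexStep u c k x - c k) := by
  simp only [convexStep]; ring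

/-- Asymptotic interpolation: close to any sequence of points in the unit sphere there is a sequence
in the open unit ball at which bounded holomorphic functions attain asymptotically any prescribed
sequence of values in the closed unit disc. -/
theorem HInf.exists_asymptotic_interpolation {E : Type*} [NormedAddCommGroup E] [NormedSpace ℂ E]
    (x : ℕ → E) (hx : ∀ k, ‖x k‖ = 1) :
    ∃ y : ℕ → ball (0 : E) 1, Tendsto (fun k => (y k : E) - x k) atTop (𝓝 0) ∧
      ∀ c : ℕ → ℂ, (∀ k, ‖c k‖ ≤ 1) →
        ∃ f : HInf E, Tendsto (fun k => (f : ball (0 : E) 1 → ℂ) (y k) - c k) atTop (𝓝 0) := by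
  obtain ⟨ψ, r, hr, hr01, hr1, hψ, hψ1, hψ0, hψr⟩ := exists_peak_sequence
  -- Norming functionals carry the peak functions from the disc to the ball: `ψ k ∘ φ k` is small on
  -- `‖z‖ ≤ r k` and near `1` at `r (k + 1) • x k`. At this point step `k` sets the value close to
  -- `c k`, and all later steps barely disturb it.
  choose φ hφ hφx using fun k => exists_dual_vector'' ℂ (x k)
  have hφle : ∀ k z, ‖φ k z‖ ≤ ‖z‖ := fun k z => by
    simpa using (φ k).le_of_opNorm_le (hφ k) z
  have hpow : Tendsto (fun k : ℕ => (1 : ℝ) / 2 ^ k) atTop (𝓝 0) := by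
    simpa [one_div] using tendsto_pow_atTop_nhds_zero_of_lt_one (r := (1 / 2 : ℝ))
      (by norm_num) (by norm_num)
  have hrlim : ∀ ρ < 1, ∃ K, ρ < r K := by
    intro ρ hρ
    obtain ⟨k, hk⟩ := (((tendsto_add_atTop_iff_nat 2).2 hpow).eventually_lt_const
      (sub_pos.2 hρ)).exists
    exact ⟨k + 1, by linarith [hr1 k]⟩
  have hynorm : ∀ k, ‖((r (k + 1) : ℂ) • x k)‖ = r (k + 1) := fun k => by
    rw [norm_smul, hx, mul_one, Complex.norm_real, Real.norm_of_nonneg (hr01 _).1]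
  refine ⟨fun k => ⟨(r (k + 1) : ℂ) • x k, by
    rw [mem_ball_zero_iff, hynorm]; exact (hr01 _).2⟩, ?_, fun c hc => ?_⟩
  · refine squeeze_zero_norm (fun k => ?_) ((tendsto_add_atTop_iff_nat 2).2 hpow)
    have : (r (k + 1) : ℂ) • x k - x k = ((r (k + 1) - 1 : ℝ) : ℂ) • x k := by
      push_cast; rw [sub_smul, one_smul]
    rw [this, norm_smul, hx, mul_one, Complex.norm_real, Real.norm_eq_abs, abs_le]
    have := hr1 k
    have := (hr01 (k + 1)).2
    have : (0 : ℝ) ≤ 1 / 2 ^ (k + 2) := by positivity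
    constructor <;> linarith
  set u : ℕ → E → ℂ := fun k z => ψ k (φ k z) with hu
  set F := convexStep u c with hF
  have hball : ∀ k, ∀ z ∈ ball (0 : E) 1, φ k z ∈ ball (0 : ℂ) 1 := fun k z hz => by
    rw [mem_ball_zero_iff] at *; exact (hφle k z).trans_lt hz
  have hFle : ∀ k, ∀ z ∈ ball (0 : E) 1, ‖F k z‖ ≤ 2 := fun k z hz =>
    (norm_convexStep_le (u := u) hc (fun k => hψ1 k _ (hball k z hz)) k).trans
      (sub_le_self _ (by positivity))
  have hFd : ∀ k, DifferentiableOn ℂ (F k) (ball 0 1) := by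
    intro k
    induction k with
    | zero => exact differentiableOn_const _
    | succ k ih =>
      have hud : DifferentiableOn ℂ (u k) (ball 0 1) :=
        (hψ k).comp (φ k).differentiable.differentiableOn (hball k)
      exact ((hud.const_sub 1).mul ih).add (hud.const_mul _)
  have hcF : ∀ k, ∀ z ∈ ball (0 : E) 1, ‖c k - F k z‖ ≤ 3 := fun k z hz =>
    (norm_sub_le _ _).trans (by linarith [hc k, hFle k z hz])
  -- From index `K` on, every `u` is small on `‖z‖ ≤ r K`. The bound `3 / 2 ^ (n + K + 2)` is
  -- written as `C / 2 / 2 ^ n` with `C = 3 / 2 / 2 ^ K`, the form of the geometric-series lemmas.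
  have hstep : ∀ K, ∀ z : E, ‖z‖ ≤ r K → ∀ n,
      dist (F (n + K) z) (F (n + 1 + K) z) ≤ 3 / 2 / 2 ^ K / 2 / 2 ^ n := by
    intro K z hz n
    have hzb : z ∈ ball (0 : E) 1 := by
      rw [mem_ball_zero_iff]; exact hz.trans_lt (hr01 K).2
    rw [dist_comm, dist_eq_norm, add_right_comm, convexStep_succ_sub, norm_mul]
    have h1 : ‖u (n + K) z‖ ≤ 1 / 2 ^ (n + K + 2) :=
      hψ0 _ _ ((hφle _ z).trans (hz.trans (hr (by omega))))
    refine (mul_le_mul h1 (hcF _ z hzb) (norm_nonneg _) (by positivity)).trans (le_of_eq ?_)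
    rw [pow_add, pow_add]; field_simp
  have hlim : ∀ z ∈ ball (0 : E) 1, ∃ w, Tendsto (fun n => F n z) atTop (𝓝 w) := by
    intro z hz
    obtain ⟨K, hK⟩ := hrlim _ (mem_ball_zero_iff.1 hz)
    obtain ⟨w, hw⟩ := cauchySeq_tendsto_of_complete
      (cauchySeq_of_le_geometric_two (hstep K z hK.le))
    exact ⟨w, (tendsto_add_atTop_iff_nat (f := fun n => F n z) K).1 hw⟩
  choose! f hf using hlim
  have hdist : ∀ K, ∀ z : E, ‖z‖ ≤ r K → ∀ n, dist (F (n + K) z) (f z) ≤ 3 / 2 / 2 ^ K / 2 ^ n := by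
    intro K z hz n
    have hzb : z ∈ ball (0 : E) 1 := by
      rw [mem_ball_zero_iff]; exact hz.trans_lt (hr01 K).2
    exact dist_le_of_le_geometric_two_of_tendsto (hstep K z hz)
      ((tendsto_add_atTop_iff_nat (f := fun n => F n z) K).2 (hf z hzb)) n
  have hfd : DifferentiableOn ℂ f (ball 0 1) := by
    intro z hz
    obtain ⟨K, hK⟩ := hrlim _ (mem_ball_zero_iff.1 hz)
    have hK' : DifferentiableOn ℂ f (ball 0 (r K)) := by
      refine DifferentiableOn.of_tendstoUniformlyOn isOpen_ball (F := fun n => F (n + K))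
        (fun n => (hFd _).mono (ball_subset_ball (hr01 K).2.le)) ?_
      rw [Metric.tendstoUniformlyOn_iff]
      intro ε hε
      have h0 : Tendsto (fun n : ℕ => 3 / 2 / 2 ^ K * ((1 : ℝ) / 2 ^ n)) atTop (𝓝 0) := by
        simpa using hpow.const_mul (3 / 2 / 2 ^ K : ℝ)
      filter_upwards [h0.eventually_lt_const hε] with n hn w hw
      rw [dist_comm]
      refine (hdist K w (mem_ball_zero_iff.1 hw).le n).trans_lt ?_
      rwa [mul_one_div] at hn
    exact (hK'.differentiableAt
      (isOpen_ball.mem_nhds (mem_ball_zero_iff.2 hK))).differentiableWithinAt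
  refine ⟨⟨fun z => f z, ⟨f, hfd, fun _ => rfl⟩, 2, fun z =>
    le_of_tendsto (hf z z.2).norm (Eventually.of_forall fun k => hFle k z z.2)⟩, ?_⟩
  have h0 : Tendsto (fun k : ℕ => 2 * ((1 : ℝ) / 2 ^ k)) atTop (𝓝 0) := by
    simpa using hpow.const_mul 2
  refine squeeze_zero_norm (fun k => ?_) h0
  set y : E := (r (k + 1) : ℂ) • x k with hy
  have hyb : y ∈ ball (0 : E) 1 := by rw [mem_ball_zero_iff, hynorm]; exact (hr01 _).2
  have h1 : ‖F (k + 1) y - f y‖ ≤ 3 / 2 / 2 ^ (k + 1) := by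
    simpa [dist_eq_norm] using hdist (k + 1) y (hynorm k).le 0
  have h2 : ‖F (k + 1) y - c k‖ ≤ 1 / 2 ^ (k + 2) * 3 := by
    rw [convexStep_succ_sub_target, norm_mul]
    have : u k y = ψ k (r (k + 1)) := by
      simp [hu, hy, hφx, hx]
    rw [this, norm_sub_rev _ (c k)]
    exact mul_le_mul (hψr k) (hcF k y hyb) (norm_nonneg _) (by positivity)
  have h3 : ‖f y - c k‖ ≤ ‖F (k + 1) y - c k‖ + ‖F (k + 1) y - f y‖ := by
    rw [show f y - c k = (F (k + 1) y - c k) - (F (k + 1) y - f y) by ring]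
    exact norm_sub_le _ _
  refine h3.trans ((add_le_add h2 h1).trans ?_)
  rw [pow_add, pow_add]
  field_simp
  norm_num

/-! ### Independent target sequences -/

/-- In a separable space there are a sequence of points and continuum many sequences in the closed
unit disc such that, infinitely often, the points come close to any given point while finitely many
of the sequences come close to any given values. -/
theorem exists_independent_targets {X : Type*} [PseudoMetricSpace X]
    [TopologicalSpace.SeparableSpace X] [Nonempty X] :
    ∃ (x : ℕ → X) (c : ℕ → (ℕ → Bool) → ℂ), (∀ k a, ‖c k a‖ ≤ 1) ∧
      ∀ (z : X) (w : (ℕ → Bool) → ℂ) (s : Finset (ℕ → Bool)), (∀ a ∈ s, ‖w a‖ ≤ 1) →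
        ∀ ε > 0, ∃ᶠ k in atTop, dist (x k) z < ε ∧ ∀ a ∈ s, dist (c k a) (w a) < ε := by
  -- An index records a point of the dense sequence and a table assigning a value to each word of
  -- `n` bits. There are only countably many such indices; the extra factor `ℕ` in `e` makes each
  -- occur infinitely often.
  let I := ℕ × (Σ n, (Fin n → Bool) → ℕ)
  have : Nonempty (closedBall (0 : ℂ) 1) := ⟨⟨0, by simp⟩⟩
  obtain ⟨e, he⟩ := exists_surjective_nat (I × ℕ)
  let q := TopologicalSpace.denseSeq (closedBall (0 : ℂ) 1)
  let target : I → (ℕ → Bool) → ℂ := fun i a => q (i.2.2 fun j => a j)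
  refine ⟨fun k => TopologicalSpace.denseSeq X (e k).1.1, fun k => target (e k).1,
    fun k a => mem_closedBall_zero_iff.1 (q _).2, ?_⟩
  intro z w s hw ε hε
  obtain ⟨i, hi⟩ := (TopologicalSpace.denseRange_denseSeq X).exists_dist_lt z hε
  have hq : ∀ a ∈ s, ∃ j, dist (q j : ℂ) (w a) < ε := by
    intro a ha
    obtain ⟨j, hj⟩ := (TopologicalSpace.denseRange_denseSeq (closedBall (0 : ℂ) 1)).exists_dist_lt
      ⟨w a, mem_closedBall_zero_iff.2 (hw a ha)⟩ hε
    exact ⟨j, by rw [dist_comm]; exact hj⟩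
  choose! j hj using hq
  -- Finitely many binary sequences are told apart by their first `n` bits, so one table can
  -- prescribe their values independently.
  obtain ⟨n, hn⟩ : ∃ n : ℕ, ∀ a ∈ s, ∀ b ∈ s, (∀ i < n, a i = b i) → a = b := by
    have h : ∀ p : (ℕ → Bool) × (ℕ → Bool), ∃ n : ℕ, (∀ i < n, p.1 i = p.2 i) → p.1 = p.2 := by
      intro p
      by_cases hp : p.1 = p.2
      · exact ⟨0, fun _ => hp⟩
      · obtain ⟨i, hi⟩ := Function.ne_iff.1 hp
        exact ⟨i + 1, fun h => absurd (h i (Nat.lt_succ_self i)) hi⟩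
    choose N hN using h
    refine ⟨(s ×ˢ s).sup N, fun a ha b hb h => hN (a, b) fun i hi => h i (hi.trans_le ?_)⟩
    exact Finset.le_sup (f := N) (Finset.mk_mem_product ha hb)
  have hinj : Set.InjOn (fun (a : ℕ → Bool) (i : Fin n) => a i) s := fun a ha b hb h =>
    hn a ha b hb fun i hi => congrFun h ⟨i, hi⟩
  let t : (Fin n → Bool) → ℕ := fun v => j (Function.invFunOn (fun a (i : Fin n) => a i) s v)
  have ht : ∀ a ∈ s, t (fun i => a i) = j a := fun a ha =>
    congrArg j (hinj.leftInvOn_invFunOn ha)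
  choose m hm using fun l : ℕ => he ((i, ⟨n, t⟩), l)
  have hminj : Function.Injective m := fun l l' h => by
    have := (hm l).symm.trans ((congrArg e h).trans (hm l'))
    exact (Prod.ext_iff.1 this).2
  refine hminj.nat_tendsto_atTop.frequently (Frequently.of_forall fun l => ?_)
  change dist (TopologicalSpace.denseSeq X (e (m l)).1.1) z < ε ∧
    ∀ a ∈ s, dist (target (e (m l)).1 a) (w a) < ε
  rw [hm]
  refine ⟨by rw [dist_comm]; exact hi, fun a ha => ?_⟩
  change dist (q (t fun i => a i) : ℂ) (w a) < ε
  rw [ht a ha]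
  exact hj a ha

/-! ### Polynomials without constant term -/

/-- A nonzero polynomial without constant term maps the unit polydisc onto a neighbourhood
of `0`. -/
theorem MvPolynomial.exists_ball_subset_eval {σ : Type*} {Q : MvPolynomial σ ℂ} (hQ : Q ≠ 0)
    (hQ0 : constantCoeff Q = 0) :
    ∃ r > 0, ∀ v ∈ ball (0 : ℂ) r, ∃ w : σ → ℂ, (∀ a ∈ Q.vars, ‖w a‖ ≤ 1) ∧ eval w Q = v := by
  obtain ⟨p, hp⟩ : ∃ p : σ → ℂ, eval p Q ≠ 0 := by
    by_contra! h
    exact hQ (funext fun p => by simp [h p])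
  set g : ℂ → ℂ := fun t => eval (fun a => t * p a) Q with hg
  have hg0 : g 0 = 0 := by
    simp only [hg, zero_mul]
    rw [eval_zero', hQ0]
  have hgd : Differentiable ℂ g := by
    simp only [hg, eval_eq]
    fun_prop
  have hga : AnalyticOnNhd ℂ g Set.univ :=
    hgd.differentiableOn.analyticOnNhd isOpen_univ
  have hopen : 𝓝 (g 0) ≤ Filter.map g (𝓝 0) := by
    refine (hga 0 (Set.mem_univ 0)).eventually_constant_or_nhds_le_map_nhds.resolve_left fun h => ?_
    have := hga.eqOn_of_preconnected_of_eventuallyEq analyticOnNhd_const isPreconnected_univ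
      (Set.mem_univ 0) h (Set.mem_univ 1)
    apply hp
    simpa [hg0, hg, hQ0] using this
  have hsmall : {t : ℂ | ∀ a ∈ Q.vars, ‖t * p a‖ ≤ 1} ∈ 𝓝 (0 : ℂ) := by
    rw [← Filter.Eventually, Finset.eventually_all]
    intro a _
    have h : Tendsto (fun t : ℂ => ‖t * p a‖) (𝓝 0) (𝓝 ‖0 * p a‖) :=
      Continuous.tendsto (by fun_prop) 0
    exact (h.eventually_lt_const (by simp)).mono fun _ => le_of_lt
  rw [hg0] at hopen
  obtain ⟨r, hr, hrs⟩ := Metric.mem_nhds_iff.1 (hopen (image_mem_map hsmall))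
  refine ⟨r, hr, fun v hv => ?_⟩
  obtain ⟨t, ht, rfl⟩ := hrs hv
  exact ⟨_, ht, rfl⟩

/-- Every element of the non-unital algebra generated by a family is the value at the family of a
polynomial without constant term. -/
theorem NonUnitalAlgebra.exists_aeval_eq_of_mem_adjoin_range {R A ι : Type*} [CommRing R]
    [CommRing A] [Algebra R A] {g : ι → A} {p : A}
    (hp : p ∈ NonUnitalAlgebra.adjoin R (Set.range g)) :
    ∃ Q : MvPolynomial ι R, MvPolynomial.constantCoeff Q = 0 ∧ MvPolynomial.aeval g Q = p := by
  induction hp using NonUnitalAlgebra.adjoin_induction with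
  | mem x hx =>
    obtain ⟨i, rfl⟩ := hx
    exact ⟨MvPolynomial.X i, by simp, by simp⟩
  | add x y _ _ hx hy =>
    obtain ⟨P, hP, rfl⟩ := hx
    obtain ⟨Q, hQ, rfl⟩ := hy
    exact ⟨P + Q, by simp [hP, hQ], by simp⟩
  | zero => exact ⟨0, by simp, by simp⟩
  | mul x y _ _ hx hy =>
    obtain ⟨P, hP, rfl⟩ := hx
    obtain ⟨Q, hQ, rfl⟩ := hy
    exact ⟨P * Q, by simp [hP], by simp⟩
  | smul r x _ hx =>
    obtain ⟨P, hP, rfl⟩ := hx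
    exact ⟨r • P, by simp [hP], by simp⟩

theorem HInf.aeval_apply {E σ : Type*} [NormedAddCommGroup E] [NormedSpace ℂ E] (g : σ → HInf E)
    (Q : MvPolynomial σ ℂ) (y : ball (0 : E) 1) :
    (MvPolynomial.aeval g Q : HInf E).1 y = MvPolynomial.eval (fun a => (g a).1 y) Q := by
  have h := MvPolynomial.comp_aeval_apply (f := g)
    ((Pi.evalAlgHom ℂ (fun _ : ball (0 : E) 1 => ℂ) y).comp (HInf E).val) Q
  rw [MvPolynomial.aeval_eq_eval] at h
  exact h

theorem MvPolynomial.tendsto_eval {σ α : Type*} {l : Filter α} (Q : MvPolynomial σ ℂ)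
    {v : α → σ → ℂ} {w : σ → ℂ} (h : ∀ a ∈ Q.vars, Tendsto (fun k => v k a) l (𝓝 (w a))) :
    Tendsto (fun k => eval (v k) Q) l (𝓝 (eval w Q)) := by
  simp only [eval_eq]
  refine tendsto_finsetSum _ fun d hd => (tendsto_finsetProd _ fun a ha => ?_).const_mul _
  exact (h a (mem_vars_iff_mem_support a |>.2 ⟨d, hd, ha⟩)).pow _

/-- On a finite-dimensional space there are continuum many bounded holomorphic functions
whose joint cluster set at every point of the unit sphere contains the closed unit polydisc. -/
theorem HInf.exists_joint_cluster (E : Type*) [NormedAddCommGroup E] [NormedSpace ℂ E]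
    [FiniteDimensional ℂ E] [Nontrivial E] :
    ∃ g : (ℕ → Bool) → HInf E, ∀ z ∈ sphere (0 : E) 1, ∀ (w : (ℕ → Bool) → ℂ)
      (s : Finset (ℕ → Bool)), (∀ a ∈ s, ‖w a‖ ≤ 1) → ∃ u : ℕ → ball (0 : E) 1,
        Tendsto (fun k => (u k : E)) atTop (𝓝 z) ∧
        ∀ a ∈ s, Tendsto (fun k => (g a).1 (u k)) atTop (𝓝 (w a)) := by
  have : ProperSpace E := FiniteDimensional.proper ℂ E
  let _ : NormedSpace ℝ E := NormedSpace.restrictScalars ℝ ℂ E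
  have : Nonempty (sphere (0 : E) 1) :=
    (NormedSpace.sphere_nonempty.2 zero_le_one).to_subtype
  obtain ⟨x, c, hc, hxc⟩ := exists_independent_targets (X := sphere (0 : E) 1)
  obtain ⟨y, hy, hyf⟩ := HInf.exists_asymptotic_interpolation (fun k => (x k : E))
    fun k => mem_sphere_zero_iff_norm.1 (x k).2
  choose g hg using fun a : ℕ → Bool => hyf (fun k => c k a) fun k => hc k a
  refine ⟨g, fun z hz w s hw => ?_⟩
  have hfreq := fun n : ℕ => hxc ⟨z, hz⟩ w s hw (1 / (n + 1)) Nat.one_div_pos_of_nat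
  obtain ⟨m, hm, hmx⟩ := Filter.extraction_forall_of_frequently hfreq
  have hm' := hm.tendsto_atTop
  refine ⟨fun n => y (m n), ?_, fun a ha => ?_⟩
  · have h1 : Tendsto (fun n => (x (m n) : E)) atTop (𝓝 z) := by
      rw [tendsto_iff_dist_tendsto_zero]
      exact squeeze_zero (fun _ => dist_nonneg) (fun n => (hmx n).1.le)
        tendsto_one_div_add_atTop_nhds_zero_nat
    simpa using (hy.comp hm').add h1
  · have h1 : Tendsto (fun n => c (m n) a) atTop (𝓝 (w a)) := by
      rw [tendsto_iff_dist_tendsto_zero]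
      exact squeeze_zero (fun _ => dist_nonneg) (fun n => ((hmx n).2 a ha).le)
        tendsto_one_div_add_atTop_nhds_zero_nat
    simpa using ((hg a).comp hm').add h1

theorem theorem1p1 (E : Type*) [NormedAddCommGroup E] [NormedSpace ℂ E]
    [FiniteDimensional ℂ E] [Nontrivial E] :
    StronglyAlgebrable Cardinal.continuum
      {f : HInf E | ∃ r : ℝ, 0 < r ∧
        ∀ z ∈ sphere (0 : E) 1, ball (0 : ℂ) r ⊆ clusterSet (f : ball (0 : E) 1 → ℂ) z} := by
  obtain ⟨g, hg⟩ := HInf.exists_joint_cluster E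
  have hcluster : ∀ (Q : MvPolynomial (ℕ → Bool) ℂ) (w : (ℕ → Bool) → ℂ),
      (∀ a ∈ Q.vars, ‖w a‖ ≤ 1) → ∀ z ∈ sphere (0 : E) 1,
      MvPolynomial.eval w Q ∈ clusterSet (MvPolynomial.aeval g Q : HInf E).1 z := by
    intro Q w hw z hz
    obtain ⟨u, hu, hgu⟩ := hg z hz w Q.vars hw
    refine ⟨u, hu, ?_⟩
    simp only [HInf.aeval_apply]
    exact Q.tendsto_eval hgu
  have hlarge : ∀ Q : MvPolynomial (ℕ → Bool) ℂ, Q ≠ 0 → MvPolynomial.constantCoeff Q = 0 →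
      ∃ r : ℝ, 0 < r ∧ ∀ z ∈ sphere (0 : E) 1,
        ball (0 : ℂ) r ⊆ clusterSet (MvPolynomial.aeval g Q : HInf E).1 z := by
    intro Q hQ hQ0
    obtain ⟨r, hr, hrQ⟩ := Q.exists_ball_subset_eval hQ hQ0
    refine ⟨r, hr, fun z hz v hv => ?_⟩
    obtain ⟨w, hw, rfl⟩ := hrQ v hv
    exact hcluster Q w hw z hz
  have hind : AlgebraicIndependent ℂ g := by
    rw [algebraicIndependent_iff]
    intro Q hQ
    let _ : NormedSpace ℝ E := NormedSpace.restrictScalars ℝ ℂ E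
    obtain ⟨z, hz⟩ : (sphere (0 : E) 1).Nonempty := NormedSpace.sphere_nonempty.2 zero_le_one
    have hval : ∀ w : (ℕ → Bool) → ℂ, (∀ a ∈ Q.vars, ‖w a‖ ≤ 1) → MvPolynomial.eval w Q = 0 := by
      intro w hw
      obtain ⟨u, -, hu⟩ := hcluster Q w hw z hz
      rw [hQ] at hu
      exact tendsto_nhds_unique hu tendsto_const_nhds
    have hQ0 : MvPolynomial.constantCoeff Q = 0 := by
      simpa using hval 0 (by simp)
    by_contra hne
    obtain ⟨r, hr, hrQ⟩ := Q.exists_ball_subset_eval hne hQ0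
    obtain ⟨w, hw, h⟩ := hrQ ((r / 2 : ℝ) : ℂ) (by
      rw [mem_ball_zero_iff, Complex.norm_real, Real.norm_of_nonneg (by positivity)]
      linarith)
    rw [hval w hw] at h
    have : r / 2 = 0 := by exact_mod_cast h.symm
    linarith
  have hinj := hind.injective
  refine ⟨Set.range g, Set.infinite_range_of_injective hinj, ?_, hind.coe_range, ?_⟩
  · have h := Cardinal.mk_range_eq_of_injective hinj
    simpa using h
  · intro p hp
    obtain ⟨Q, hQ0, rfl⟩ := NonUnitalAlgebra.exists_aeval_eq_of_mem_adjoin_range hp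
    by_cases hQ : Q = 0
    · right; simp [hQ]
    · left; exact hlarge Q hQ hQ0
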